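/- For $\nu\in[0,1)$ let $\mathcal A^+(\nu)$ be the set of functions $f(\theta)=\sum_{k=1}^\infty a_k e^{ik\theta}$, $\theta\in[-\pi,\pi]$, with $a_k\ge 0$, $\sum_{k=1}^\infty a_k=1$ and $\sum_{k=1}^\infty k^\nu a_k<\infty$. Write $F(z)=\sum_{k=1}^\infty a_k z^k$ for $|z|\le 1$, so that $f(\theta)=F(e^{i\theta})$. Call $f$ aperiodic if $F(z)=1$ with $|z|\le1$ implies $z=1$, and put $R_f(\theta)=\dfrac{\theta}{1-f(\theta)}$ for $\theta\in[-\pi,\pi]$ (defined almost everywhere if $f$ is aperiodic). Then: (i) if $\nu\in(0,1)$ and $f\in\mathcal A^+(\nu)$ is aperiodic, then $R_f\in L^p[-\pi,\pi]$ for $p=1+\frac{1}{1-\nu}$; (ii) for every $\nu\in[0,1)$ and every $p\in\left(2+\frac{1}{1-\nu},\infty\right)$ there is an aperiodic $f\in\mathcal A^+(\nu)$ such that $R_f\notin L^p[-\pi,\pi]$. -/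

import Mathlib

open MeasureTheory

noncomputable section

/-- The class `𝒜⁺(ν)`: functions given on the closed unit disc by a power series
`F z = ∑_{k ≥ 1} a_k z ^ k` with `a_k ≥ 0`, `∑ a_k = 1` and `∑ k ^ ν * a_k < ∞`.
The coefficients are indexed by `ℕ` with `a_0 = 0`; the values of `F` off the closed disc
play no role. -/
def APlus (ν : ℝ) : Set (ℂ → ℂ) :=
  {F | ∃ a : ℕ → ℝ, a 0 = 0 ∧ (∀ k, 0 ≤ a k) ∧ HasSum a 1 ∧
    Summable (fun k : ℕ => (k : ℝ) ^ ν * a k) ∧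
    ∀ z : ℂ, ‖z‖ ≤ 1 → HasSum (fun k : ℕ => (a k : ℂ) * z ^ k) (F z)}

/-- `F` is aperiodic: on the closed unit disc it takes the value `1` at most at `z = 1`. -/
def IsAperiodic (F : ℂ → ℂ) : Prop :=
  ∀ z : ℂ, ‖z‖ ≤ 1 → F z = 1 → z = 1

/-- The periodic function `f θ = F (e ^ {i θ})` of boundary values of `F`. -/
def boundaryFun (F : ℂ → ℂ) (θ : ℝ) : ℂ :=
  F (Complex.exp (Complex.I * (θ : ℂ)))

/-- `R_f θ = θ / (1 - f θ)`, where `f` is the boundary function of `F`. -/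
def R (F : ℂ → ℂ) (θ : ℝ) : ℂ :=
  (θ : ℂ) / (1 - boundaryFun F θ)

end

/-! Write `w = 1 - f`. For (i), two facts are combined. First, `Re (1 / w)` is integrable: it is
nonnegative, the means of `Re (1 / (1 - r F))` over the circle all equal the value 1 at the centre,
and Fatou's lemma lets `r → 1` (`integrable_re_inv_one_sub`). Second, the moment condition gives `c
|θ| / 2 ≤ |Im w| + C |θ| ^ (ν - 1) * Re w` near 0 (`mul_abs_le_abs_im_add` with a suitable `l`). If
`|Im w|` dominates, `|θ| / ‖w‖` is bounded. If `Re w` dominates, `|θ| ^ (2 - ν)` is at most a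
constant times `Re w`, and for `p = (2 - ν) / (1 - ν)` this gives `(|θ| / ‖w‖) ^ p ≤ C' * Re w / ‖w‖
^ 2 = C' * Re (1 / w)` (`rpow_div_norm_le`). Away from 0, aperiodicity and compactness bound `R`.

For (ii), take a very sparse series with weight about `n ^ (-β)` at frequency `n`. Just below `2π /
n` the imaginary contribution of frequency `n` cancels that of all lower frequencies. With `θ = (2π
- x) / n`, the cancellation is at some `x = r` of order at most `n ^ (-(1 - β))` up to small powers
of `n`, and on `|x - r| ≤ r ^ 2` one gets `‖R‖` at least of order `1 / r`, up to the mean `μ` of the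
lower frequencies. This set of `θ` has length `2 r ^ 2 / n`, so the integral of `‖R‖ ^ p` is at
least about `r ^ (2 - p) / n`, unbounded in `n` once `(1 - β) (p - 2) > 1`. Some `β > ν` satisfies
this exactly when `p > 2 + 1 / (1 - ν)`. -/

section PowerSeries

/-! ### Regularity of the power series on the disc. -/

variable {a : ℕ → ℝ} {F : ℂ → ℂ}

lemma norm_coeff_mul_pow_le (ha : ∀ k, 0 ≤ a k) {z : ℂ} (hz : ‖z‖ ≤ 1) (k : ℕ) :
    ‖(a k : ℂ) * z ^ k‖ ≤ a k := by
  rw [norm_mul, norm_pow, Complex.norm_real, Real.norm_of_nonneg (ha k)]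
  exact mul_le_of_le_one_right (ha k) (pow_le_one₀ (norm_nonneg _) hz)

lemma continuousOn_of_hasSum (ha : ∀ k, 0 ≤ a k) (hs : HasSum a 1)
    (hF : ∀ z : ℂ, ‖z‖ ≤ 1 → HasSum (fun k : ℕ => (a k : ℂ) * z ^ k) (F z)) :
    ContinuousOn F (Metric.closedBall 0 1) := by
  have h : ContinuousOn (fun z : ℂ => ∑' k, (a k : ℂ) * z ^ k) (Metric.closedBall 0 1) :=
    continuousOn_tsum (fun k => by fun_prop) hs.summable fun k z hz =>
      norm_coeff_mul_pow_le ha (by simpa using hz) k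
  exact h.congr fun z hz => (hF z (by simpa using hz)).tsum_eq.symm

lemma differentiableOn_of_hasSum (ha : ∀ k, 0 ≤ a k) (hs : HasSum a 1)
    (hF : ∀ z : ℂ, ‖z‖ ≤ 1 → HasSum (fun k : ℕ => (a k : ℂ) * z ^ k) (F z)) :
    DifferentiableOn ℂ F (Metric.ball 0 1) := by
  have h : DifferentiableOn ℂ (fun z : ℂ => ∑' k, (a k : ℂ) * z ^ k) (Metric.ball 0 1) :=
    Complex.differentiableOn_tsum_of_summable_norm hs.summable (fun k => by fun_prop)
      Metric.isOpen_ball fun k z hz =>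
        norm_coeff_mul_pow_le ha (by simpa using (Metric.ball_subset_closedBall hz)) k
  exact h.congr fun z hz =>
    (hF z (by simpa using (Metric.ball_subset_closedBall hz))).tsum_eq.symm

lemma norm_le_one_of_hasSum (ha : ∀ k, 0 ≤ a k) (hs : HasSum a 1)
    (hF : ∀ z : ℂ, ‖z‖ ≤ 1 → HasSum (fun k : ℕ => (a k : ℂ) * z ^ k) (F z))
    {z : ℂ} (hz : ‖z‖ ≤ 1) : ‖F z‖ ≤ 1 := by
  rw [← (hF z hz).tsum_eq]
  exact tsum_of_norm_bounded hs (norm_coeff_mul_pow_le ha hz)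

lemma map_zero_of_hasSum (h0 : a 0 = 0)
    (hF : ∀ z : ℂ, ‖z‖ ≤ 1 → HasSum (fun k : ℕ => (a k : ℂ) * z ^ k) (F z)) : F 0 = 0 := by
  refine (hF 0 (by simp)).unique ?_
  convert hasSum_zero with k
  rcases eq_or_ne k 0 with rfl | hk <;> simp [*]

end PowerSeries

/-! ### Integrability of the real part of `1 / (1 - f)`. -/

lemma norm_exp_I_mul_ofReal (θ : ℝ) : ‖Complex.exp (Complex.I * (θ : ℂ))‖ = 1 := by
  rw [mul_comm, Complex.norm_exp_ofReal_mul_I]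

lemma continuous_boundaryFun {F : ℂ → ℂ} (hF : ContinuousOn F (Metric.closedBall 0 1)) :
    Continuous (boundaryFun F) :=
  hF.comp_continuous (by fun_prop) fun θ => by simp

lemma one_sub_re_pos {w : ℂ} {r : ℝ} (hw : ‖w‖ ≤ 1) (hr0 : 0 ≤ r) (hr : r < 1) :
    0 < (1 - (r : ℂ) * w).re := by
  have h1 : ((r : ℂ) * w).re ≤ ‖(r : ℂ) * w‖ := Complex.re_le_norm _
  rw [norm_mul, Complex.norm_real, Real.norm_of_nonneg hr0] at h1
  have : r * ‖w‖ ≤ r := mul_le_of_le_one_right hr0 hw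
  simp only [Complex.sub_re, Complex.one_re]
  linarith

/-- The mean value property for `1 / (1 - r F)`. -/
lemma integral_inv_one_sub_mul {F : ℂ → ℂ} (hc : ContinuousOn F (Metric.closedBall 0 1))
    (hd : DifferentiableOn ℂ F (Metric.ball 0 1)) (h1 : ∀ z, ‖z‖ ≤ 1 → ‖F z‖ ≤ 1)
    (h0 : F 0 = 0) {r : ℝ} (hr0 : 0 ≤ r) (hr : r < 1) :
    ∫ θ in (-Real.pi)..Real.pi, (1 - (r : ℂ) * boundaryFun F θ)⁻¹ = 2 * Real.pi := by
  have hne : ∀ z : ℂ, ‖z‖ ≤ 1 → 1 - (r : ℂ) * F z ≠ 0 := fun z hz h => by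
    have := one_sub_re_pos (h1 z hz) hr0 hr
    rw [h] at this
    simp at this
  have hD : DiffContOnCl ℂ (fun z => (1 - (r : ℂ) * F z)⁻¹) (Metric.ball 0 |1|) := by
    rw [abs_one]
    refine ⟨((differentiableOn_const _).sub (hd.const_mul _)).inv fun z hz =>
      hne z (by simpa using Metric.ball_subset_closedBall hz), ?_⟩
    rw [closure_ball _ one_ne_zero]
    exact (continuousOn_const.sub (continuousOn_const.mul hc)).inv₀ fun z hz =>
      hne z (by simpa using hz)
  have h := hD.circleAverage
  rw [Real.circleAverage_eq_integral_add (-Real.pi),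
    intervalIntegral.integral_comp_add_right
      (fun θ => (1 - (r : ℂ) * F (circleMap 0 1 θ))⁻¹), h0] at h
  have e1 : 0 + -Real.pi = -Real.pi := by ring
  have e2 : 2 * Real.pi + -Real.pi = Real.pi := by ring
  rw [e1, e2] at h
  have h2 : (2 * Real.pi)⁻¹ • ∫ θ in (-Real.pi)..Real.pi, (1 - (r : ℂ) * boundaryFun F θ)⁻¹
      = 1 := by
    simpa [boundaryFun, circleMap, mul_comm] using h
  have hpi : (2 * Real.pi) ≠ 0 := by positivity
  rw [inv_smul_eq_iff₀ hpi] at h2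
  rw [h2]
  simp

/-- The integrals for radii `r < 1` all equal `2π` by the mean value property, and the integrands
are nonnegative because `‖F‖ ≤ 1`; Fatou's lemma passes to `r = 1`. -/
lemma integrable_re_inv_one_sub {F : ℂ → ℂ} (hc : ContinuousOn F (Metric.closedBall 0 1))
    (hd : DifferentiableOn ℂ F (Metric.ball 0 1)) (h1 : ∀ z, ‖z‖ ≤ 1 → ‖F z‖ ≤ 1)
    (h0 : F 0 = 0) :
    Integrable (fun θ => ((1 - boundaryFun F θ)⁻¹).re)
      (volume.restrict (Set.Icc (-Real.pi) Real.pi)) := by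
  have hb := continuous_boundaryFun hc
  have hm : Measurable fun θ => ((1 - boundaryFun F θ)⁻¹).re :=
    Complex.measurable_re.comp (measurable_const.sub hb.measurable).inv
  have hn : ∀ θ, ‖boundaryFun F θ‖ ≤ 1 := fun θ => h1 _ (norm_exp_I_mul_ofReal θ).le
  have hre : ∀ θ, 0 ≤ ((1 - boundaryFun F θ)⁻¹).re := fun θ => by
    rw [Complex.inv_re]
    refine div_nonneg ?_ (Complex.normSq_nonneg _)
    have := (Complex.re_le_norm _).trans (hn θ)
    simpa using this
  refine ⟨hm.aestronglyMeasurable, ?_⟩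
  rw [hasFiniteIntegral_iff_ofReal (Filter.Eventually.of_forall hre)]
  set r : ℕ → ℝ := fun n => 1 - 1 / ((n : ℝ) + 1) with hr_def
  have hr0 : ∀ n, 0 ≤ r n := fun n => by
    have : 1 / ((n : ℝ) + 1) ≤ 1 := (div_le_one (by positivity)).2 (by linarith [n.cast_nonneg (α := ℝ)])
    simp only [hr_def]; linarith
  have hr1 : ∀ n, r n < 1 := fun n => by
    have : 0 < 1 / ((n : ℝ) + 1) := by positivity
    simp only [hr_def]; linarith
  have hrt : Filter.Tendsto r Filter.atTop (nhds 1) := by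
    simpa [hr_def] using (tendsto_one_div_add_atTop_nhds_zero_nat (𝕜 := ℝ)).const_sub 1
  have hcont : ∀ n, Continuous fun θ => (1 - (r n : ℂ) * boundaryFun F θ)⁻¹ := fun n =>
    (continuous_const.sub (continuous_const.mul hb)).inv₀ fun θ h => by
      have := one_sub_re_pos (hn θ) (hr0 n) (hr1 n)
      rw [show 1 - (r n : ℂ) * boundaryFun F θ = 0 from h] at this
      simp at this
  have hint : ∀ n, ∫⁻ θ in Set.Icc (-Real.pi) Real.pi,
      ENNReal.ofReal ((1 - (r n : ℂ) * boundaryFun F θ)⁻¹).re = ENNReal.ofReal (2 * Real.pi) := by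
    intro n
    have hci : Integrable (fun θ => (1 - (r n : ℂ) * boundaryFun F θ)⁻¹)
        (volume.restrict (Set.Icc (-Real.pi) Real.pi)) :=
      (hcont n).continuousOn.integrableOn_compact isCompact_Icc
    have hre' : Integrable (fun θ => ((1 - (r n : ℂ) * boundaryFun F θ)⁻¹).re)
        (volume.restrict (Set.Icc (-Real.pi) Real.pi)) := hci.re
    rw [← ofReal_integral_eq_lintegral_ofReal hre']
    · congr 1
      have e := integral_re hci
      have h2 := integral_inv_one_sub_mul hc hd h1 h0 (hr0 n) (hr1 n)
      rw [intervalIntegral.integral_of_le (by linarith [Real.pi_pos]),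
        ← integral_Icc_eq_integral_Ioc] at h2
      rw [h2] at e
      simpa using e
    · refine Filter.Eventually.of_forall fun θ => ?_
      simp only [Pi.zero_apply, Complex.inv_re]
      exact div_nonneg (one_sub_re_pos (hn θ) (hr0 n) (hr1 n)).le (Complex.normSq_nonneg _)
  calc ∫⁻ θ in Set.Icc (-Real.pi) Real.pi, ENNReal.ofReal ((1 - boundaryFun F θ)⁻¹).re
      ≤ ∫⁻ θ in Set.Icc (-Real.pi) Real.pi, Filter.liminf
          (fun n => ENNReal.ofReal ((1 - (r n : ℂ) * boundaryFun F θ)⁻¹).re) Filter.atTop := by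
        refine lintegral_mono fun θ => ?_
        by_cases hθ : 1 - boundaryFun F θ = 0
        -- Where `f = 1` the inverse is 0 by convention, so the left side vanishes.
        · simp [hθ]
        · have ht : Filter.Tendsto (fun n => (1 - (r n : ℂ) * boundaryFun F θ)⁻¹) Filter.atTop
              (nhds (1 - boundaryFun F θ)⁻¹) := by
            refine Filter.Tendsto.inv₀ ?_ hθ
            have h3 : Filter.Tendsto (fun n => ((r n : ℝ) : ℂ)) Filter.atTop (nhds 1) := by
              exact ((Complex.continuous_ofReal.tendsto 1).comp hrt).trans (by simp)
            simpa using (h3.mul_const (boundaryFun F θ)).const_sub 1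
          exact (ENNReal.tendsto_ofReal
            ((Complex.continuous_re.tendsto _).comp ht)).liminf_eq.ge
    _ ≤ Filter.liminf (fun n => ∫⁻ θ in Set.Icc (-Real.pi) Real.pi,
          ENNReal.ofReal ((1 - (r n : ℂ) * boundaryFun F θ)⁻¹).re) Filter.atTop :=
        lintegral_liminf_le fun n =>
          ENNReal.measurable_ofReal.comp (Complex.measurable_re.comp (hcont n).measurable)
    _ < ⊤ := by simp only [hint, Filter.liminf_const, ENNReal.ofReal_lt_top]

/-! ### Lower bounds for `1 - f` near the origin. -/

/-- The sine is negative only beyond `π`, where `x ^ ν ≥ 1`; there `sin² ≤ 2 (1 - cos)` and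
completing the square suffice. -/
lemma sin_add_mul_one_sub_cos_nonneg {x l ν : ℝ} (hx : 0 ≤ x) (hl : 0 < l) (hν : 0 ≤ ν) :
    0 ≤ Real.sin x + l * (1 - Real.cos x) + x ^ ν / (2 * l) := by
  have hc : 0 ≤ 1 - Real.cos x := by linarith [Real.cos_le_one x]
  rcases le_total x Real.pi with h | h
  · have := Real.sin_nonneg_of_nonneg_of_le_pi hx h
    positivity
  · have hx1 : 1 ≤ x ^ ν := Real.one_le_rpow (by linarith [Real.pi_gt_three]) hν
    have h1 : 1 / (2 * l) ≤ x ^ ν / (2 * l) := by gcongr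
    have h2 : Real.sin x ^ 2 ≤ 2 * (1 - Real.cos x) := by
      nlinarith [Real.sin_sq_add_cos_sq x, Real.neg_one_le_cos x]
    have h3 : l * Real.sin x ^ 2 ≤ l * (2 * (1 - Real.cos x)) := by gcongr
    have h4 : 0 ≤ (l * Real.sin x + 1) ^ 2 / (2 * l) := by positivity
    have h5 : (l * Real.sin x + 1) ^ 2 / (2 * l) =
        l * Real.sin x ^ 2 / 2 + Real.sin x + 1 / (2 * l) := by
      field_simp; ring
    linarith

lemma hasSum_boundaryFun_re_im {a : ℕ → ℝ} {F : ℂ → ℂ}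
    (hF : ∀ z : ℂ, ‖z‖ ≤ 1 → HasSum (fun k : ℕ => (a k : ℂ) * z ^ k) (F z)) (θ : ℝ) :
    HasSum (fun k : ℕ => a k * Real.cos (k * θ)) (boundaryFun F θ).re ∧
      HasSum (fun k : ℕ => a k * Real.sin (k * θ)) (boundaryFun F θ).im := by
  have h := hF _ (norm_exp_I_mul_ofReal θ).le
  have e : ∀ k : ℕ, (a k : ℂ) * Complex.exp (Complex.I * (θ : ℂ)) ^ k =
      ((a k * Real.cos (k * θ) : ℝ) : ℂ) + ((a k * Real.sin (k * θ) : ℝ) : ℂ) * Complex.I := by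
    intro k
    rw [← Complex.exp_nat_mul, show (k : ℂ) * (Complex.I * θ) = ((k * θ : ℝ) : ℂ) * Complex.I by
      push_cast; ring, Complex.exp_mul_I]
    push_cast
    ring
  simp only [e] at h
  exact ⟨by simpa [-Complex.ofReal_mul, boundaryFun] using Complex.hasSum_re h,
    by simpa [-Complex.ofReal_mul, boundaryFun] using Complex.hasSum_im h⟩

/-- The preceding inequality at `x = k |θ|`, weighted by `a k`, makes every term of the sum
nonnegative. Hence the sum dominates its single term `k₀`, which Jordan's inequality `sin x ≥ 2 x /
π` bounds below. -/
lemma mul_abs_le_abs_im_add {a : ℕ → ℝ} {F : ℂ → ℂ} {ν S : ℝ} (hν : 0 ≤ ν)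
    (ha : ∀ k, 0 ≤ a k) (hs : HasSum a 1) (hS : HasSum (fun k : ℕ => (k : ℝ) ^ ν * a k) S)
    (hF : ∀ z : ℂ, ‖z‖ ≤ 1 → HasSum (fun k : ℕ => (a k : ℂ) * z ^ k) (F z))
    {k₀ : ℕ} {θ l : ℝ} (hθ : k₀ * |θ| ≤ Real.pi / 2) (hl : 0 < l) :
    a k₀ * (2 / Real.pi * (k₀ * |θ|)) ≤
      |(boundaryFun F θ).im| + l * (1 - boundaryFun F θ).re + |θ| ^ ν * S / (2 * l) := by
  obtain ⟨hre, him⟩ := hasSum_boundaryFun_re_im hF θ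
  have hre' : HasSum (fun k : ℕ => a k * Real.cos (k * |θ|)) (boundaryFun F θ).re := by
    convert hre using 3 with k
    rw [← Real.cos_abs (k * θ), abs_mul, Nat.abs_cast]
  obtain ⟨b, hb, him'⟩ : ∃ b, b ≤ |(boundaryFun F θ).im| ∧
      HasSum (fun k : ℕ => a k * Real.sin (k * |θ|)) b := by
    rcases le_total 0 θ with h | h
    · exact ⟨_, le_abs_self _, by simpa only [abs_of_nonneg h] using him⟩
    · refine ⟨_, neg_le_abs _, ?_⟩
      have e : (fun k : ℕ => a k * Real.sin (k * |θ|)) =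
          fun k : ℕ => -(a k * Real.sin (k * θ)) := by
        funext k
        rw [abs_of_nonpos h, mul_neg, Real.sin_neg, mul_neg]
      rw [e]
      exact him.neg
  have hsum : HasSum (fun k : ℕ => a k * (Real.sin (k * |θ|) + l * (1 - Real.cos (k * |θ|)) +
      (k * |θ|) ^ ν / (2 * l)))
      (b + l * (1 - (boundaryFun F θ).re) + |θ| ^ ν / (2 * l) * S) := by
    convert (him'.add ((hs.sub hre').mul_left l)).add (hS.mul_left (|θ| ^ ν / (2 * l))) using 2
      with k
    rw [Real.mul_rpow (Nat.cast_nonneg k) (abs_nonneg θ)]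
    ring
  have hnn : ∀ k : ℕ, 0 ≤ Real.sin (k * |θ|) + l * (1 - Real.cos (k * |θ|)) +
      (k * |θ|) ^ ν / (2 * l) := fun k => sin_add_mul_one_sub_cos_nonneg (by positivity) hl hν
  have h1 := le_hasSum hsum k₀ fun k _ => mul_nonneg (ha k) (hnn k)
  have h2 : 2 / Real.pi * (k₀ * |θ|) ≤ Real.sin (k₀ * |θ|) + l * (1 - Real.cos (k₀ * |θ|)) +
      (k₀ * |θ|) ^ ν / (2 * l) := by
    have h3 := Real.mul_le_sin (x := k₀ * |θ|) (by positivity) hθ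
    have h4 : 0 ≤ l * (1 - Real.cos (k₀ * |θ|)) :=
      mul_nonneg hl.le (by linarith [Real.cos_le_one (k₀ * |θ|)])
    have h5 : 0 ≤ ((k₀ : ℝ) * |θ|) ^ ν / (2 * l) := by positivity
    linarith
  have h6 := (mul_le_mul_of_nonneg_left h2 (ha k₀)).trans h1
  simp only [Complex.sub_re, Complex.one_re]
  linarith [show |θ| ^ ν / (2 * l) * S = |θ| ^ ν * S / (2 * l) by ring]

/-- Either `|Im w| ≥ c t / 4`, which gives the constant term, or `Re w` carries the bound. In the
second case, with `q = 1 / (1 - ν) ≥ 1`, the exponent `1 + q` is chosen so that `t ^ (1 + q) = (t ^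
(2 - ν)) ^ q`, and `(Re w) ^ q ≤ Re w * ‖w‖ ^ (q - 1)` leaves `Re w / ‖w‖ ^ 2`. -/
lemma rpow_div_norm_le {ν c S t : ℝ} (hν0 : 0 < ν) (hν : ν < 1) (hc : 0 < c) (hS : 0 < S)
    (ht : 0 < t) {w : ℂ} (hw : 0 ≤ w.re)
    (h : c * t / 2 ≤ |w.im| + S / c * t ^ (ν - 1) * w.re) :
    (t / ‖w‖) ^ (1 + 1 / (1 - ν)) ≤
      (4 / c) ^ (1 + 1 / (1 - ν)) + (4 * S / c ^ 2) ^ (1 / (1 - ν)) * (w⁻¹).re := by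
  have h1ν : 0 < 1 - ν := by linarith
  have hp : 0 < 1 / (1 - ν) := by positivity
  have hq : 1 ≤ 1 / (1 - ν) := by rw [le_div_iff₀ h1ν]; linarith
  have hUnn : 0 ≤ (w⁻¹).re := by
    rw [Complex.inv_re]; exact div_nonneg hw (Complex.normSq_nonneg _)
  rcases le_total (c * t / 4) |w.im| with h4 | h4
  · have hD : c * t / 4 ≤ ‖w‖ := h4.trans (Complex.abs_im_le_norm w)
    have : t / ‖w‖ ≤ 4 / c := by
      rw [div_le_div_iff₀ (lt_of_lt_of_le (by positivity) hD) hc]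
      linarith
    have h5 : (t / ‖w‖) ^ (1 + 1 / (1 - ν)) ≤ (4 / c) ^ (1 + 1 / (1 - ν)) :=
      Real.rpow_le_rpow (by positivity) this (by positivity)
    have : 0 ≤ (4 * S / c ^ 2) ^ (1 / (1 - ν)) * (w⁻¹).re := by positivity
    linarith
  · have hA : t ^ (2 - ν) ≤ 4 * S / c ^ 2 * w.re := by
      have h5 : c * t / 4 ≤ S / c * t ^ (ν - 1) * w.re := by linarith
      have h6 : t = t ^ (2 - ν) * t ^ (ν - 1) := by
        rw [← Real.rpow_add ht]; norm_num
      have h7 : 0 < t ^ (ν - 1) := by positivity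
      have h8 : c / 4 * t ^ (2 - ν) ≤ S / c * w.re := by
        refine le_of_mul_le_mul_right ?_ h7
        calc c / 4 * t ^ (2 - ν) * t ^ (ν - 1) = c * t / 4 := by
              conv_rhs => rw [h6]
              ring
          _ ≤ _ := h5
          _ = _ := by ring
      have h9 := mul_le_mul_of_nonneg_left h8 (show 0 ≤ 4 / c by positivity)
      calc t ^ (2 - ν) = 4 / c * (c / 4 * t ^ (2 - ν)) := by field_simp
        _ ≤ _ := h9
        _ = _ := by field_simp
    have hApos : 0 < w.re := by
      have : 0 < 4 * S / c ^ 2 * w.re := lt_of_lt_of_le (by positivity) hA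
      exact pos_of_mul_pos_right this (by positivity)
    have hAD : w.re ≤ ‖w‖ := Complex.re_le_norm w
    have hDpos : 0 < ‖w‖ := hApos.trans_le hAD
    have htp : t ^ (1 + 1 / (1 - ν)) ≤
        (4 * S / c ^ 2) ^ (1 / (1 - ν)) * w.re ^ (1 / (1 - ν)) := by
      rw [← Real.mul_rpow (by positivity) hw]
      calc t ^ (1 + 1 / (1 - ν)) = (t ^ (2 - ν)) ^ (1 / (1 - ν)) := by
            rw [← Real.rpow_mul ht.le]
            congr 1
            field_simp
            ring
        _ ≤ _ := Real.rpow_le_rpow (by positivity) hA hp.le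
    have hAq : w.re ^ (1 / (1 - ν)) ≤ w.re * ‖w‖ ^ (1 / (1 - ν) - 1) := by
      calc w.re ^ (1 / (1 - ν)) = w.re * w.re ^ (1 / (1 - ν) - 1) := by
            rw [← Real.rpow_one_add' hw (by linarith)]
            congr 1
            ring
        _ ≤ _ := by gcongr
    have hDp : ‖w‖ ^ (1 + 1 / (1 - ν)) = ‖w‖ ^ (1 / (1 - ν) - 1) * ‖w‖ ^ 2 := by
      rw [← Real.rpow_natCast ‖w‖ 2, ← Real.rpow_add hDpos]
      congr 1
      push_cast
      ring
    have hmain : (t / ‖w‖) ^ (1 + 1 / (1 - ν)) ≤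
        (4 * S / c ^ 2) ^ (1 / (1 - ν)) * (w⁻¹).re := by
      rw [Real.div_rpow ht.le hDpos.le, div_le_iff₀ (by positivity), Complex.inv_re,
        Complex.normSq_eq_norm_sq, hDp]
      calc t ^ (1 + 1 / (1 - ν)) ≤ _ := htp
        _ ≤ (4 * S / c ^ 2) ^ (1 / (1 - ν)) * (w.re * ‖w‖ ^ (1 / (1 - ν) - 1)) := by gcongr
        _ = _ := by field_simp
    have : 0 ≤ (4 / c) ^ (1 + 1 / (1 - ν)) := by positivity
    linarith

/-- The local bound near the origin. -/
lemma exists_norm_R_rpow_le_near_zero {F : ℂ → ℂ} {ν : ℝ} (hν0 : 0 < ν) (hν : ν < 1)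
    (hF : F ∈ APlus ν) :
    ∃ t₀ > 0, ∃ C ≥ 0, ∃ D ≥ 0, ∀ θ : ℝ, |θ| ≤ t₀ →
      ‖R F θ‖ ^ (1 + 1 / (1 - ν)) ≤ C + D * ((1 - boundaryFun F θ)⁻¹).re := by
  obtain ⟨a, h0, ha, hs, ⟨S, hS⟩, hF⟩ := hF
  obtain ⟨k₀, hk₀⟩ : ∃ k, a k ≠ 0 := by
    by_contra! h
    rw [show a = fun _ => (0 : ℝ) from funext h] at hs
    exact one_ne_zero (hs.unique hasSum_zero)
  have hk1 : 0 < (k₀ : ℝ) := by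
    rcases Nat.eq_zero_or_pos k₀ with rfl | h
    · exact absurd h0 hk₀
    · exact_mod_cast h
  have hak : 0 < a k₀ := lt_of_le_of_ne (ha k₀) hk₀.symm
  have hSpos : 0 < S := lt_of_lt_of_le (by positivity)
    (le_hasSum hS k₀ fun k _ => mul_nonneg (by positivity) (ha k))
  set c : ℝ := a k₀ * (2 / Real.pi * k₀) with hc_def
  have hc : 0 < c := by have := Real.pi_pos; positivity
  have hp : 0 < 1 / (1 - ν) := by
    have : 0 < 1 - ν := by linarith
    positivity
  refine ⟨Real.pi / 2 / k₀, by have := Real.pi_pos; positivity, (4 / c) ^ (1 + 1 / (1 - ν)),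
    by positivity, (4 * S / c ^ 2) ^ (1 / (1 - ν)), by positivity, fun θ hθ => ?_⟩
  have hre : 0 ≤ (1 - boundaryFun F θ).re := by
    have := (Complex.re_le_norm _).trans
      (norm_le_one_of_hasSum ha hs hF (norm_exp_I_mul_ofReal θ).le)
    simpa [boundaryFun] using this
  have hR : ‖R F θ‖ = |θ| / ‖1 - boundaryFun F θ‖ := by simp [R]
  rcases eq_or_ne θ 0 with rfl | hθ0
  · have : 0 ≤ ((1 - boundaryFun F 0)⁻¹).re := by
      rw [Complex.inv_re]; exact div_nonneg hre (Complex.normSq_nonneg _)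
    rw [hR, abs_zero, zero_div, Real.zero_rpow (by positivity)]
    positivity
  · have ht : 0 < |θ| := abs_pos.2 hθ0
    rw [hR]
    refine rpow_div_norm_le hν0 hν hc hSpos ht hre ?_
    -- This value of `l` makes the moment term equal to `c |θ| / 2`, half of the left side.
    have hl : 0 < S / c * |θ| ^ (ν - 1) := by positivity
    have := mul_abs_le_abs_im_add (k₀ := k₀) hν0.le ha hs hS hF (θ := θ)
      (by rw [le_div_iff₀ hk1] at hθ; linarith) hl
    have e1 : |θ| ^ ν * S / (2 * (S / c * |θ| ^ (ν - 1))) = c * |θ| / 2 := by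
      rw [Real.rpow_sub_one ht.ne']
      field_simp
    have e2 : a k₀ * (2 / Real.pi * (k₀ * |θ|)) = c * |θ| := by rw [hc_def]; ring
    have e3 : |(1 - boundaryFun F θ).im| = |(boundaryFun F θ).im| := by simp
    rw [e1, e2] at this
    rw [e3]
    linarith

/-! ### Integrability on the whole interval. -/

lemma boundaryFun_ne_one {F : ℂ → ℂ} (hF : IsAperiodic F) {θ : ℝ} (hθ : |θ| ≤ Real.pi)
    (h0 : θ ≠ 0) : boundaryFun F θ ≠ 1 := by
  intro h
  have h1 := hF _ (norm_exp_I_mul_ofReal θ).le h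
  rw [Complex.exp_eq_one_iff] at h1
  obtain ⟨n, hn⟩ := h1
  have h2 : θ = n * (2 * Real.pi) := by
    have h3 : Complex.I * (θ : ℂ) = Complex.I * ((n * (2 * Real.pi) : ℝ) : ℂ) := by
      rw [hn]; push_cast; ring
    exact_mod_cast mul_left_cancel₀ Complex.I_ne_zero h3
  have hn0 : n ≠ 0 := by rintro rfl; simp at h2; exact h0 h2
  have hn1 : (1 : ℝ) ≤ |(n : ℝ)| := by exact_mod_cast Int.one_le_abs hn0
  rw [h2, abs_mul, abs_of_pos (by positivity : 0 < 2 * Real.pi)] at hθ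
  nlinarith [Real.pi_pos]

/-- Membership of `R F` in `L ^ (1 + 1 / (1 - ν))`. -/
theorem memLp_R_of_mem_APlus {F : ℂ → ℂ} {ν : ℝ} (hν0 : 0 < ν) (hν : ν < 1)
    (hF : F ∈ APlus ν) (hap : IsAperiodic F) :
    MemLp (R F) (ENNReal.ofReal (1 + 1 / (1 - ν)))
      (volume.restrict (Set.Icc (-Real.pi) Real.pi)) := by
  obtain ⟨t₀, ht₀, C, hC, D, hD, hnear⟩ := exists_norm_R_rpow_le_near_zero hν0 hν hF
  obtain ⟨a, h0, ha, hs, -, hF⟩ := hF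
  have hc := continuousOn_of_hasSum ha hs hF
  have hb := continuous_boundaryFun hc
  have hint := integrable_re_inv_one_sub hc (differentiableOn_of_hasSum ha hs hF)
    (fun z hz => norm_le_one_of_hasSum ha hs hF hz) (map_zero_of_hasSum h0 hF)
  have hp : 0 < 1 + 1 / (1 - ν) := by
    have : 0 < 1 - ν := by linarith
    positivity
  have hmeas : Measurable (R F) :=
    Complex.continuous_ofReal.measurable.div (measurable_const.sub hb.measurable)
  have hK : IsCompact {θ : ℝ | θ ∈ Set.Icc (-Real.pi) Real.pi ∧ t₀ ≤ |θ|} :=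
    isCompact_Icc.inter_right (isClosed_le continuous_const continuous_abs)
  have hRc : ContinuousOn (R F) {θ : ℝ | θ ∈ Set.Icc (-Real.pi) Real.pi ∧ t₀ ≤ |θ|} := by
    refine Complex.continuous_ofReal.continuousOn.div
      (continuous_const.sub hb).continuousOn fun θ hθ h => ?_
    exact boundaryFun_ne_one hap (abs_le.2 hθ.1) (abs_pos.1 (ht₀.trans_le hθ.2))
      (sub_eq_zero.1 h).symm
  obtain ⟨M, hM⟩ := hK.exists_bound_of_continuousOn hRc
  have hpt : (ENNReal.ofReal (1 + 1 / (1 - ν))).toReal = 1 + 1 / (1 - ν) :=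
    ENNReal.toReal_ofReal hp.le
  rw [← integrable_norm_rpow_iff hmeas.aestronglyMeasurable (by simpa using hp)
    ENNReal.ofReal_ne_top, hpt]
  refine Integrable.mono' (((integrable_const (C + |M| ^ (1 + 1 / (1 - ν)))).add
    (hint.const_mul D))) (hmeas.norm.pow_const _).aestronglyMeasurable ?_
  filter_upwards [ae_restrict_mem measurableSet_Icc] with θ hθ
  rw [Real.norm_of_nonneg (by positivity), Pi.add_apply]
  have hre : 0 ≤ ((1 - boundaryFun F θ)⁻¹).re := by
    rw [Complex.inv_re]
    refine div_nonneg ?_ (Complex.normSq_nonneg _)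
    have := (Complex.re_le_norm _).trans
      (norm_le_one_of_hasSum ha hs hF (norm_exp_I_mul_ofReal θ).le)
    simpa [boundaryFun] using this
  have hM0 : 0 ≤ |M| ^ (1 + 1 / (1 - ν)) := by positivity
  rcases le_total |θ| t₀ with h | h
  · linarith [hnear θ h]
  · have h1 : ‖R F θ‖ ^ (1 + 1 / (1 - ν)) ≤ |M| ^ (1 + 1 / (1 - ν)) :=
      Real.rpow_le_rpow (norm_nonneg _) ((hM θ ⟨hθ, h⟩).trans (le_abs_self M)) hp.le
    have := mul_nonneg hD hre
    linarith

/-! ### Sparse series and cancellation near `2π / n`. -/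

/-- The power series with coefficient `e j` at the exponent `N j`. -/
noncomputable def sparseSeries (N : ℕ → ℕ) (e : ℕ → ℝ) (z : ℂ) : ℂ :=
  ∑' j, (e j : ℂ) * z ^ N j

section SparseSeries

variable {N : ℕ → ℕ} {e : ℕ → ℝ}

lemma hasSum_sparseSeries (he : ∀ j, 0 ≤ e j) (hs : Summable e) {z : ℂ} (hz : ‖z‖ ≤ 1) :
    HasSum (fun j => (e j : ℂ) * z ^ N j) (sparseSeries N e z) := by
  refine Summable.hasSum (Summable.of_norm_bounded hs fun j => ?_)
  rw [norm_mul, norm_pow, Complex.norm_real, Real.norm_of_nonneg (he j)]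
  exact mul_le_of_le_one_right (he j) (pow_le_one₀ (norm_nonneg _) hz)

lemma sparseSeries_mem_APlus {ν : ℝ} (hN : StrictMono N) (hN0 : N 0 = 1) (he : ∀ j, 0 ≤ e j)
    (hs : HasSum e 1) (hν : Summable fun j => (N j : ℝ) ^ ν * e j) :
    sparseSeries N e ∈ APlus ν := by
  have hinj := hN.injective
  have hext : ∀ j, Function.extend N e 0 (N j) = e j := fun j => hinj.extend_apply _ _ _
  have hext0 : ∀ k, k ∉ Set.range N → Function.extend N e 0 k = 0 := fun k hk =>
    Function.extend_apply' _ _ _ hk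
  refine ⟨Function.extend N e 0, hext0 0 ?_, fun k => ?_, ?_, ?_, fun z hz => ?_⟩
  · rintro ⟨j, hj⟩
    have := hN.monotone (Nat.zero_le j)
    omega
  · by_cases hk : k ∈ Set.range N
    · obtain ⟨j, rfl⟩ := hk
      rw [hext]
      exact he j
    · rw [hext0 k hk]
  · rw [← hinj.hasSum_iff hext0]
    simpa [Function.comp_def, hext] using hs
  · rw [← hinj.summable_iff fun k hk => by rw [hext0 k hk, mul_zero]]
    simpa [Function.comp_def, hext] using hν
  · rw [← hinj.hasSum_iff fun k hk => by rw [hext0 k hk]; simp]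
    simpa [Function.comp_def, hext] using hasSum_sparseSeries he hs.summable hz

/-- Equality in a convex combination of numbers of real part at most 1 forces the term of frequency
1, which has positive weight, to be 1. -/
lemma isAperiodic_sparseSeries (hN0 : N 0 = 1) (he : ∀ j, 0 ≤ e j)
    (hs : HasSum e 1) (he0 : 0 < e 0) : IsAperiodic (sparseSeries N e) := by
  intro z hz h
  have h1 := Complex.hasSum_re (hasSum_sparseSeries (N := N) he hs.summable hz)
  rw [h] at h1
  have h2 := hs.sub h1
  have hle : ∀ j, (z ^ N j).re ≤ 1 := fun j => (Complex.re_le_norm _).trans (by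
    rw [norm_pow]; exact pow_le_one₀ (norm_nonneg _) hz)
  have hnn : ∀ j, 0 ≤ e j - ((e j : ℂ) * z ^ N j).re := fun j => by
    rw [Complex.re_ofReal_mul]
    nlinarith [he j, hle j]
  have h3 := le_hasSum h2 0 fun j _ => hnn j
  rw [Complex.re_ofReal_mul, hN0, pow_one, Complex.one_re, sub_self] at h3
  have h4 : 1 ≤ z.re := by nlinarith
  have h5 : z.re ^ 2 + z.im ^ 2 ≤ 1 := by
    have h6 := Complex.sq_norm z
    rw [Complex.normSq_apply] at h6
    nlinarith [norm_nonneg z]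
  have him : z.im = 0 := by nlinarith [sq_nonneg z.im]
  have hre : z.re = 1 := by nlinarith [sq_nonneg z.im]
  exact Complex.ext (by simpa using hre) (by simpa using him)

lemma norm_one_sub_exp_add_le {y : ℝ} (hy0 : 0 ≤ y) (hy : y ≤ 1) :
    ‖1 - Complex.exp (Complex.I * (y : ℂ)) + Complex.I * (y : ℂ)‖ ≤ y ^ 2 := by
  have hn : ‖Complex.I * (y : ℂ)‖ = y := by simp [abs_of_nonneg hy0]
  have := Complex.norm_exp_sub_one_sub_id_le (x := Complex.I * (y : ℂ)) (hn.trans_le hy)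
  rw [hn] at this
  rw [← norm_neg]
  refine le_of_eq_of_le (congrArg _ ?_) this
  ring

/-- Near `2 π / N (J + 1)` the linear terms of the lower frequencies compete with that of the
frequency `N (J + 1)`. -/
lemma norm_one_sub_boundaryFun_sparseSeries_le (hN : StrictMono N) (he : ∀ j, 0 ≤ e j)
    (hs : HasSum e 1) {J : ℕ} {τ x : ℝ} (hτ : HasSum (fun i => e (i + (J + 2))) τ)
    (hmn : 7 * N J ≤ N (J + 1)) (hn : 0 < N (J + 1)) (hx0 : 0 ≤ x) (hx : x ≤ 1) :
    ‖1 - boundaryFun (sparseSeries N e) ((2 * Real.pi - x) / N (J + 1))‖ ≤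
      |(e (J + 1) + (∑ i ∈ Finset.range (J + 1), e i * N i) / N (J + 1)) * x -
        2 * Real.pi * (∑ i ∈ Finset.range (J + 1), e i * N i) / N (J + 1)| +
      N J ^ 2 * ((2 * Real.pi - x) / N (J + 1)) ^ 2 + e (J + 1) * x ^ 2 + 2 * τ := by
  set n : ℝ := ((N (J + 1) : ℕ) : ℝ) with hn_def
  set θ : ℝ := (2 * Real.pi - x) / n with hθ_def
  set μ : ℝ := ∑ i ∈ Finset.range (J + 1), e i * N i with hμ_def
  set ε : ℝ := e (J + 1) with hε_def
  have hn' : 0 < n := by simp only [hn_def]; exact_mod_cast hn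
  have hmn' : 7 * (N J : ℝ) ≤ n := by simp only [hn_def]; exact_mod_cast hmn
  have hπ := Real.pi_gt_three
  have hπ' := Real.pi_lt_d2
  have hθ0 : 0 ≤ θ := div_nonneg (by linarith) hn'.le
  have hnθ : n * θ = 2 * Real.pi - x := by simp only [hθ_def]; field_simp
  -- The factor 7 in `hmn` is there to exceed `2π`.
  have hmθ : N J * θ ≤ 1 := by nlinarith
  set E : ℕ → ℂ := fun j => Complex.exp (Complex.I * ((N j * θ : ℝ) : ℂ)) with hE_def
  have hEn : ∀ j, ‖E j‖ = 1 := fun j => norm_exp_I_mul_ofReal _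
  have hpow : ∀ j, Complex.exp (Complex.I * (θ : ℂ)) ^ N j = E j := fun j => by
    rw [hE_def, ← Complex.exp_nat_mul]
    congr 1
    push_cast
    ring
  have hsum : HasSum (fun j => (e j : ℂ) * (1 - E j)) (1 - boundaryFun (sparseSeries N e) θ) := by
    have h1 := hasSum_sparseSeries (N := N) he hs.summable (norm_exp_I_mul_ofReal θ).le
    simp only [hpow] at h1
    have h2 : HasSum (fun j => (e j : ℂ)) 1 := by
      simpa using Complex.hasSum_ofReal.2 hs
    simpa [mul_sub, boundaryFun] using h2.sub h1
  have hsplit := hsum.summable.sum_add_tsum_nat_add (J + 2)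
  rw [hsum.tsum_eq, Finset.sum_range_succ] at hsplit
  have htail : ‖∑' i, (e (i + (J + 2)) : ℂ) * (1 - E (i + (J + 2)))‖ ≤ 2 * τ := by
    refine tsum_of_norm_bounded (hτ.mul_left 2) fun i => ?_
    rw [norm_mul, Complex.norm_real, Real.norm_of_nonneg (he _), mul_comm]
    refine mul_le_mul_of_nonneg_right ((norm_sub_le _ _).trans ?_) (he _)
    rw [hEn, norm_one]
    norm_num
  have hmid : ‖(ε : ℂ) * (1 - E (J + 1)) - ((ε * x : ℝ) : ℂ) * Complex.I‖ ≤ ε * x ^ 2 := by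
    -- Since `n θ = 2π - x`, the linear term of this frequency is `+ i ε x`, opposite in sign to the
    -- `- i μ θ` of the lower ones.
    have e1 : E (J + 1) = (starRingEnd ℂ) (Complex.exp (Complex.I * (x : ℂ))) := by
      rw [← Complex.exp_conj]
      simp only [hE_def, ← hn_def, hnθ]
      rw [map_mul, Complex.conj_I, Complex.conj_ofReal,
        ← Complex.exp_periodic (-Complex.I * x)]
      congr 1
      push_cast
      ring
    have e2 : (ε : ℂ) * (1 - E (J + 1)) - ((ε * x : ℝ) : ℂ) * Complex.I =
        (ε : ℂ) * (starRingEnd ℂ)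
          (1 - Complex.exp (Complex.I * (x : ℂ)) + Complex.I * (x : ℂ)) := by
      rw [e1]
      simp
      ring
    rw [e2, norm_mul, Complex.norm_real, Real.norm_of_nonneg (he _), Complex.norm_conj]
    exact mul_le_mul_of_nonneg_left (norm_one_sub_exp_add_le hx0 hx) (he _)
  have hhead : ‖(∑ i ∈ Finset.range (J + 1), (e i : ℂ) * (1 - E i)) +
      ((μ * θ : ℝ) : ℂ) * Complex.I‖ ≤ N J ^ 2 * θ ^ 2 := by
    have e1 : (∑ i ∈ Finset.range (J + 1), (e i : ℂ) * (1 - E i)) +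
        ((μ * θ : ℝ) : ℂ) * Complex.I =
        ∑ i ∈ Finset.range (J + 1), (e i : ℂ) *
          (1 - E i + Complex.I * ((N i * θ : ℝ) : ℂ)) := by
      simp only [mul_add, Finset.sum_add_distrib, hμ_def]
      congr 1
      push_cast
      rw [Finset.sum_mul, Finset.sum_mul]
      exact Finset.sum_congr rfl fun i _ => by ring
    rw [e1]
    calc _ ≤ ∑ i ∈ Finset.range (J + 1), e i * (N J ^ 2 * θ ^ 2) := by
          refine norm_sum_le_of_le _ fun i hi => ?_
          have hi' : (N i : ℝ) ≤ N J := by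
            exact_mod_cast hN.monotone (Nat.lt_succ_iff.1 (Finset.mem_range.1 hi))
          have h1 : N i * θ ≤ N J * θ := mul_le_mul_of_nonneg_right hi' hθ0
          rw [norm_mul, Complex.norm_real, Real.norm_of_nonneg (he _)]
          refine mul_le_mul_of_nonneg_left ?_ (he _)
          refine (norm_one_sub_exp_add_le (by positivity) (h1.trans hmθ)).trans ?_
          rw [← mul_pow]
          exact pow_le_pow_left₀ (by positivity) h1 2
      _ = (∑ i ∈ Finset.range (J + 1), e i) * (N J ^ 2 * θ ^ 2) := by rw [Finset.sum_mul]
      _ ≤ _ := mul_le_of_le_one_left (by positivity)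
          (sum_le_hasSum _ (fun i _ => he i) hs)
  have hlin : ‖((ε * x : ℝ) : ℂ) * Complex.I - ((μ * θ : ℝ) : ℂ) * Complex.I‖ =
      |(ε + μ / n) * x - 2 * Real.pi * μ / n| := by
    rw [← sub_mul, norm_mul, Complex.norm_I, mul_one, ← Complex.ofReal_sub, Complex.norm_real,
      Real.norm_eq_abs]
    congr 1
    simp only [hθ_def]
    field_simp
    ring
  rw [← hsplit, ← hlin]
  calc _ = ‖(((ε * x : ℝ) : ℂ) * Complex.I - ((μ * θ : ℝ) : ℂ) * Complex.I) +
        ((∑ i ∈ Finset.range (J + 1), (e i : ℂ) * (1 - E i)) +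
          ((μ * θ : ℝ) : ℂ) * Complex.I) +
        ((ε : ℂ) * (1 - E (J + 1)) - ((ε * x : ℝ) : ℂ) * Complex.I) +
        ∑' i, (e (i + (J + 2)) : ℂ) * (1 - E (i + (J + 2)))‖ := by
          congr 1
          ring
    _ ≤ _ := by
        refine (norm_add_le _ _).trans (add_le_add ((norm_add_le _ _).trans
          (add_le_add ((norm_add_le _ _).trans (add_le_add le_rfl hhead)) hmid)) htail)

/-- A lower bound for `∫ ‖R‖ ^ p` coming from a neighbourhood of `2 π / N (J + 1)`. -/
lemma le_integral_norm_R_sparseSeries (hN : StrictMono N) (hN0 : N 0 = 1)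
    (he : ∀ j, 0 ≤ e j) (hs : HasSum e 1) (he0 : 1 / 2 ≤ e 0) {J : ℕ} {τ μ n m s r p : ℝ}
    (hτ : HasSum (fun i => e (i + (J + 2))) τ) (hp : 0 < p)
    (hμ : μ = ∑ i ∈ Finset.range (J + 1), e i * N i) (hn : n = N (J + 1)) (hm : m = N J)
    (hse : s = e (J + 1) + μ / n) (hr : r = 2 * Real.pi * μ / (n * s))
    (hmn : 7 * m ≤ n) (hr4 : r ≤ 1 / 4) (hms : m ^ 2 * s ≤ 1) (hτn : τ ≤ 1 / n ^ 2)
    (hint : Integrable (fun θ => ‖R (sparseSeries N e) θ‖ ^ p)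
      (volume.restrict (Set.Icc (-Real.pi) Real.pi))) :
    (1 / (20 * Real.pi * μ * r)) ^ p * (2 * r ^ 2 / n) ≤
      ∫ θ in Set.Icc (-Real.pi) Real.pi, ‖R (sparseSeries N e) θ‖ ^ p := by
  have hπ := Real.pi_gt_three
  have hN1 : ∀ j, 1 ≤ N j := fun j => hN0 ▸ hN.monotone (Nat.zero_le j)
  have hm1 : 1 ≤ m := by rw [hm]; exact_mod_cast hN1 J
  have hn0 : 0 < n := by linarith
  have hμ2 : 1 / 2 ≤ μ := by
    have h1 := Finset.single_le_sum (f := fun i => e i * N i) (s := Finset.range (J + 1))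
      (fun i _ => mul_nonneg (he i) (Nat.cast_nonneg _)) (Finset.mem_range.2 (Nat.succ_pos J))
    simp only [hN0, Nat.cast_one, mul_one] at h1
    linarith
  have hε := he (J + 1)
  have hs0 : 0 < s := by
    rw [hse]
    have : 0 < μ / n := by positivity
    linarith
  have hεs : e (J + 1) ≤ s := by
    rw [hse]
    have : 0 < μ / n := by positivity
    linarith
  have hs1 : s ≤ 1 := (le_mul_of_one_le_left hs0.le (one_le_pow₀ hm1)).trans hms
  have hr0 : 0 < r := by rw [hr]; positivity
  have hrr : r ^ 2 ≤ r / 4 := by nlinarith only [hr0, hr4]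
  have hsr : s * r = 2 * Real.pi * μ / n := by rw [hr]; field_simp
  have hsr2 : (2 * Real.pi * μ) ^ 2 = n ^ 2 * s * (s * r ^ 2) := by
    have : 2 * Real.pi * μ = n * (s * r) := by rw [hsr]; field_simp
    rw [this]; ring
  -- From `n s r = 2πμ` and `μ ≥ 1 / 2`: errors of order `1 / n ^ 2` become comparable with `s r ^
  -- 2`.
  have hκ : Real.pi ^ 2 ≤ n ^ 2 * s * (s * r ^ 2) := by
    rw [← hsr2]
    exact pow_le_pow_left₀ (by positivity) (by nlinarith only [hμ2, hπ]) 2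
  -- The linear part is `s (x - r)`; the half-width `r ^ 2` makes it no larger than the quadratic
  -- error in `x`. The four errors add up to `(1 + 4 + 4 + 1) s r ^ 2`.
  have hapx : ∀ x, |x - r| ≤ r ^ 2 →
      1 / (20 * Real.pi * μ * r) ≤ ‖R (sparseSeries N e) ((2 * Real.pi - x) / n)‖ := by
    intro x hx
    obtain ⟨hx1, hx2⟩ := abs_le.1 hx
    have hx0 : 0 ≤ x := by linarith only [hx1, hrr, hr0]
    have hx2r : x ≤ 2 * r := by linarith only [hx2, hrr, hr0]
    have hxle : x ≤ 1 := by linarith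
    set θ := (2 * Real.pi - x) / n with hθ
    have hθn : n * θ = 2 * Real.pi - x := by rw [hθ]; field_simp
    have hθ1 : 1 / n ≤ θ := by rw [hθ]; gcongr; linarith
    have hθ0 : 0 < θ := lt_of_lt_of_le (by positivity) hθ1
    have hθπ : θ ≤ Real.pi := by nlinarith only [hθn, hx0, hmn, hm1, hθ0]
    have hne : 1 - boundaryFun (sparseSeries N e) θ ≠ 0 := fun h =>
      boundaryFun_ne_one (isAperiodic_sparseSeries hN0 he hs (by linarith))
        (by rwa [abs_of_pos hθ0]) hθ0.ne' (sub_eq_zero.1 h).symm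
    have hbound := norm_one_sub_boundaryFun_sparseSeries_le hN he hs hτ (x := x)
      (by have := hmn; rw [hm, hn] at this; exact_mod_cast this) (hN1 _) hx0 hxle
    rw [← hμ, ← hn, ← hm, ← hse, ← hθ] at hbound
    have b1 : |s * x - 2 * Real.pi * μ / n| ≤ s * r ^ 2 := by
      rw [← hsr, ← mul_sub, abs_mul, abs_of_pos hs0]
      gcongr
    have b2 : m ^ 2 * θ ^ 2 ≤ 4 * (s * r ^ 2) := by
      have h1 : n ^ 2 * (m ^ 2 * θ ^ 2) ≤ n ^ 2 * (4 * (s * r ^ 2)) := by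
        have h2 : (n * θ) ^ 2 ≤ (2 * Real.pi) ^ 2 :=
          pow_le_pow_left₀ (by positivity) (by linarith) 2
        calc n ^ 2 * (m ^ 2 * θ ^ 2) = m ^ 2 * (n * θ) ^ 2 := by ring
          _ ≤ m ^ 2 * (2 * Real.pi) ^ 2 := by gcongr
          _ = 4 * m ^ 2 * Real.pi ^ 2 := by ring
          _ ≤ 4 * m ^ 2 * (n ^ 2 * s * (s * r ^ 2)) := by gcongr
          _ = (m ^ 2 * s) * (n ^ 2 * (4 * (s * r ^ 2))) := by ring
          _ ≤ n ^ 2 * (4 * (s * r ^ 2)) := mul_le_of_le_one_left (by positivity) hms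
      exact le_of_mul_le_mul_left h1 (by positivity)
    have b3 : e (J + 1) * x ^ 2 ≤ 4 * (s * r ^ 2) := by
      calc e (J + 1) * x ^ 2 ≤ s * (2 * r) ^ 2 := by gcongr
        _ = _ := by ring
    have b4 : 2 * τ ≤ s * r ^ 2 := by
      have h1 : 2 ≤ n ^ 2 * (s * r ^ 2) := by
        have h2 : n ^ 2 * s * (s * r ^ 2) ≤ n ^ 2 * 1 * (s * r ^ 2) := by gcongr
        have h9 : (2 : ℝ) ≤ Real.pi ^ 2 := by nlinarith only [hπ]
        linarith only [hκ, h2, h9]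
      have h3 : 2 * (1 / n ^ 2) ≤ s * r ^ 2 := by
        rw [mul_one_div, div_le_iff₀ (by positivity)]
        linarith only [h1]
      linarith only [h3, hτn]
    have hD : ‖1 - boundaryFun (sparseSeries N e) θ‖ ≤ 10 * (s * r ^ 2) := by
      linarith only [hbound, b1, b2, b3, b4]
    have hDpos : 0 < ‖1 - boundaryFun (sparseSeries N e) θ‖ := norm_pos_iff.2 hne
    calc 1 / (20 * Real.pi * μ * r) = (1 / n) / (10 * (s * r ^ 2)) := by
          have : 20 * Real.pi * μ * r = n * (10 * (s * r ^ 2)) := by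
            have h5 : 2 * Real.pi * μ = n * (s * r) := by rw [hsr]; field_simp
            linear_combination 10 * r * h5
          rw [this, div_div]
      _ ≤ θ / ‖1 - boundaryFun (sparseSeries N e) θ‖ := by gcongr
      _ = ‖R (sparseSeries N e) θ‖ := by simp [R, abs_of_pos hθ0]
  set lam : ℝ := 1 / (20 * Real.pi * μ * r) with hlam
  have hlam0 : 0 < lam := by positivity
  -- Markov's inequality reduces the claim to the length `2 r ^ 2 / n` of the interval of good `θ`.
  have hcheb := mul_meas_ge_le_integral_of_nonneg
    (Filter.Eventually.of_forall fun θ => by positivity) hint (lam ^ p)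
  refine le_trans (mul_le_mul_of_nonneg_left ?_ (by positivity)) hcheb
  have hsub : Set.Icc ((2 * Real.pi - (r + r ^ 2)) / n) ((2 * Real.pi - (r - r ^ 2)) / n) ⊆
      {θ | lam ^ p ≤ ‖R (sparseSeries N e) θ‖ ^ p} ∩ Set.Icc (-Real.pi) Real.pi := by
    intro θ hθ
    rw [Set.mem_Icc, div_le_iff₀ hn0, le_div_iff₀ hn0] at hθ
    have hx : |(2 * Real.pi - θ * n) - r| ≤ r ^ 2 := abs_le.2 ⟨by linarith, by linarith⟩
    have h1 := hapx _ hx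
    rw [show (2 * Real.pi - (2 * Real.pi - θ * n)) / n = θ by field_simp; ring] at h1
    refine ⟨Real.rpow_le_rpow hlam0.le h1 hp.le, ?_, ?_⟩
    · have h2 : 0 < θ * n := by linarith only [hθ.1, hrr, hr4, hπ]
      have := pos_of_mul_pos_left h2 hn0.le
      linarith only [this, hπ]
    · have h2 : θ * n ≤ Real.pi * 2 := by linarith only [hθ.2, hrr, hr0]
      have h3 : Real.pi * 2 ≤ Real.pi * n :=
        mul_le_mul_of_nonneg_left (by linarith only [hmn, hm1]) (by linarith only [hπ])
      exact le_of_mul_le_mul_right (h2.trans h3) hn0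
  have hvol := measureReal_mono hsub (μ := volume)
    (ne_of_lt ((measure_mono Set.inter_subset_right).trans_lt (by simp)))
  have hle : (2 * Real.pi - (r + r ^ 2)) / n ≤ (2 * Real.pi - (r - r ^ 2)) / n := by
    gcongr
    linarith only [sq_nonneg r]
  rw [Real.volume_real_Icc_of_le hle] at hvol
  rw [measureReal_restrict_apply' measurableSet_Icc]
  refine le_trans (le_of_eq ?_) hvol
  field_simp
  ring

end SparseSeries

/-! ### The lacunary choice of exponents and weights. -/

/-- A super-exponentially growing sequence of exponents. -/
def lacunaryExponent (b : ℕ) : ℕ → ℕ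
  | 0 => 1
  | J + 1 => (2 ^ (J + 8) * lacunaryExponent b J) ^ b

/-- The coefficients at the exponents `lacunaryExponent b (j + 1)`. -/
noncomputable def lacunaryTail (b : ℕ) (β : ℝ) (j : ℕ) : ℝ :=
  (1 / 2) ^ (j + 2) * (lacunaryExponent b (j + 1) : ℝ) ^ (-β)

/-- Coefficients of total mass one extending `lacunaryTail`. -/
noncomputable def lacunaryWeight (b : ℕ) (β : ℝ) : ℕ → ℝ
  | 0 => 1 - ∑' j, lacunaryTail b β j
  | j + 1 => lacunaryTail b β j

section Lacunary

variable {b : ℕ} {β : ℝ}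

lemma one_le_lacunaryExponent (b j : ℕ) : 1 ≤ lacunaryExponent b j := by
  induction j with
  | zero => exact le_rfl
  | succ j ih => exact Nat.one_le_pow _ _ (Nat.mul_pos (by positivity) ih)

lemma strictMono_lacunaryExponent (hb : b ≠ 0) : StrictMono (lacunaryExponent b) := by
  refine strictMono_nat_of_lt_succ fun j => ?_
  have h1 := one_le_lacunaryExponent b j
  have h2 : 2 ≤ 2 ^ (j + 8) := Nat.le_self_pow (by omega) 2
  calc lacunaryExponent b j < 2 * lacunaryExponent b j := by omega
    _ ≤ 2 ^ (j + 8) * lacunaryExponent b j := Nat.mul_le_mul_right _ h2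
    _ ≤ _ := Nat.le_self_pow hb _

lemma hasSum_half_pow : HasSum (fun j : ℕ => (1 / 2 : ℝ) ^ (j + 2)) (1 / 2) := by
  have h := (hasSum_geometric_two).mul_right ((1 / 2 : ℝ) ^ 2)
  simp only [← pow_add] at h
  rwa [show (2 : ℝ) * (1 / 2) ^ 2 = 1 / 2 by norm_num] at h

lemma lacunaryTail_nonneg (b : ℕ) (β : ℝ) (j : ℕ) : 0 ≤ lacunaryTail b β j := by
  unfold lacunaryTail; positivity

lemma lacunaryTail_le (hβ : 0 ≤ β) (j : ℕ) : lacunaryTail b β j ≤ (1 / 2) ^ (j + 2) := by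
  refine mul_le_of_le_one_right (by positivity) (Real.rpow_le_one_of_one_le_of_nonpos ?_ ?_)
  · exact_mod_cast one_le_lacunaryExponent b (j + 1)
  · linarith

lemma summable_lacunaryTail (b : ℕ) (hβ : 0 ≤ β) : Summable (lacunaryTail b β) :=
  Summable.of_nonneg_of_le (lacunaryTail_nonneg b β) (lacunaryTail_le hβ)
    hasSum_half_pow.summable

lemma half_le_lacunaryWeight_zero (b : ℕ) (hβ : 0 ≤ β) : 1 / 2 ≤ lacunaryWeight b β 0 := by
  have := hasSum_le (lacunaryTail_le hβ) (summable_lacunaryTail b hβ).hasSum hasSum_half_pow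
  unfold lacunaryWeight
  linarith

lemma lacunaryWeight_nonneg (b : ℕ) (hβ : 0 ≤ β) (j : ℕ) : 0 ≤ lacunaryWeight b β j := by
  cases j with
  | zero => linarith [half_le_lacunaryWeight_zero b hβ]
  | succ j => exact lacunaryTail_nonneg b β j

lemma hasSum_lacunaryWeight (b : ℕ) (hβ : 0 ≤ β) : HasSum (lacunaryWeight b β) 1 := by
  rw [← hasSum_nat_add_iff' 1]
  simpa [lacunaryWeight] using (summable_lacunaryTail b hβ).hasSum

lemma summable_rpow_mul_lacunaryWeight {ν : ℝ} (b : ℕ) (hν : ν ≤ β) :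
    Summable fun j => (lacunaryExponent b j : ℝ) ^ ν * lacunaryWeight b β j := by
  rw [← summable_nat_add_iff 1]
  refine Summable.of_nonneg_of_le (fun j => mul_nonneg (by positivity)
    (lacunaryTail_nonneg b β j)) (fun j => ?_) hasSum_half_pow.summable
  have h1 : (1 : ℝ) ≤ lacunaryExponent b (j + 1) := by
    exact_mod_cast one_le_lacunaryExponent b (j + 1)
  simp only [lacunaryWeight, lacunaryTail]
  rw [mul_left_comm, ← Real.rpow_add (by linarith)]
  exact mul_le_of_le_one_right (by positivity)
    (Real.rpow_le_one_of_one_le_of_nonpos h1 (by linarith))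

lemma exists_hasSum_lacunaryWeight_tail (hb : b ≠ 0) (hβ : 0 ≤ β) (J : ℕ) :
    ∃ τ ≤ (lacunaryExponent b (J + 2) : ℝ) ^ (-β),
      HasSum (fun i => lacunaryWeight b β (i + (J + 2))) τ := by
  have hsum := (summable_nat_add_iff (J + 2)).2 (hasSum_lacunaryWeight b hβ).summable
  have hN : (1 : ℝ) ≤ lacunaryExponent b (J + 2) := by
    exact_mod_cast one_le_lacunaryExponent b (J + 2)
  have hterm : ∀ i, lacunaryWeight b β (i + (J + 2)) ≤
      (1 / 2) ^ (i + 2) * (lacunaryExponent b (J + 2) : ℝ) ^ (-β) := by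
    intro i
    rw [show i + (J + 2) = (i + J + 1) + 1 by ring, lacunaryWeight, lacunaryTail]
    have hle : (lacunaryExponent b (J + 2) : ℝ) ≤ lacunaryExponent b (i + J + 1 + 1) := by
      exact_mod_cast (strictMono_lacunaryExponent hb).monotone (by omega)
    generalize (lacunaryExponent b (J + 2) : ℝ) = X at hN hle ⊢
    generalize (lacunaryExponent b (i + J + 1 + 1) : ℝ) = Y at hle ⊢
    have h1 : (1 / 2 : ℝ) ^ (i + J + 1 + 2) ≤ (1 / 2) ^ (i + 2) :=
      pow_le_pow_of_le_one (by norm_num) (by norm_num) (by omega)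
    have h2 : Y ^ (-β) ≤ X ^ (-β) :=
      Real.rpow_le_rpow_of_nonpos (by linarith) hle (by linarith)
    exact mul_le_mul h1 h2 (Real.rpow_nonneg (by linarith) _) (by positivity)
  refine ⟨_, ?_, hsum.hasSum⟩
  generalize (lacunaryExponent b (J + 2) : ℝ) = X at hN hterm ⊢
  have hX : 0 ≤ X ^ (-β) := by positivity
  have := hasSum_le hterm hsum.hasSum (hasSum_half_pow.mul_right (X ^ (-β)))
  linarith

/-- With `L = 2 ^ (J + 8) * m` and `n = L ^ b`, all constants and lower frequencies are absorbed in
powers of `L`. `hb1` makes `m ^ 2 * ε` and the tail small, `hb2` makes `r` small, `hb3` gives `L ^ 3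
≤ n`, and `hb4` makes the final exponent of `L` at least 1. -/
lemma le_integral_norm_R_lacunary {p : ℝ} (hβ0 : 0 < β) (hp : 2 < p)
    (hb1 : 2 ≤ b * β) (hb2 : 2 ≤ b * (1 - β)) (hb3 : 3 ≤ b)
    (hb4 : 2 * p ≤ b * ((1 - β) * (p - 2) - 1))
    (hint : Integrable
      (fun θ => ‖R (sparseSeries (lacunaryExponent b) (lacunaryWeight b β)) θ‖ ^ p)
      (volume.restrict (Set.Icc (-Real.pi) Real.pi))) (J : ℕ) :
    (2 : ℝ) ^ J ≤ ∫ θ in Set.Icc (-Real.pi) Real.pi,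
      ‖R (sparseSeries (lacunaryExponent b) (lacunaryWeight b β)) θ‖ ^ p := by
  have hb : b ≠ 0 := by omega
  have hmono := strictMono_lacunaryExponent hb
  have hπ := Real.pi_gt_three
  have hπ' := Real.pi_lt_d2
  obtain ⟨τ, hτle, hτ⟩ := exists_hasSum_lacunaryWeight_tail hb hβ0.le J
  have he := lacunaryWeight_nonneg b hβ0.le
  have hs := hasSum_lacunaryWeight b hβ0.le
  set m : ℝ := ((lacunaryExponent b J : ℕ) : ℝ) with hm
  set n : ℝ := ((lacunaryExponent b (J + 1) : ℕ) : ℝ) with hn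
  set μ : ℝ := ∑ i ∈ Finset.range (J + 1), lacunaryWeight b β i * lacunaryExponent b i with hμ
  set ε : ℝ := lacunaryWeight b β (J + 1) with hε
  set L : ℝ := 2 ^ (J + 8) * m with hL
  have hm1 : 1 ≤ m := by rw [hm]; exact_mod_cast one_le_lacunaryExponent b J
  have hnL : n = L ^ b := by
    rw [hn, hL, hm, lacunaryExponent]; push_cast; rfl
  have h2J : (1 : ℝ) ≤ 2 ^ J := one_le_pow₀ (by norm_num)
  have hL' : L = 256 * 2 ^ J * m := by rw [hL]; ring
  have hJm : (2 : ℝ) ^ J ≤ 2 ^ J * m := le_mul_of_one_le_right (by positivity) hm1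
  have hLJ : 256 * 2 ^ J ≤ L := by rw [hL']; linarith
  have hLm : 256 * m ≤ L := by
    have := le_mul_of_one_le_left (by linarith : 0 ≤ m) h2J
    rw [hL']; linarith
  have hL1 : 256 ≤ L := by linarith
  have hL0 : 0 < L := by linarith
  have hpow : ∀ x : ℝ, n ^ x = L ^ (b * x) := fun x => by
    rw [hnL, ← Real.rpow_natCast, ← Real.rpow_mul hL0.le]
  have hn3 : L ^ 3 ≤ n := by rw [hnL]; exact pow_le_pow_right₀ (by linarith) hb3
  have hLn : L ≤ L ^ 3 := le_self_pow₀ (by linarith) (by norm_num)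
  have hn0 : 0 < n := by linarith
  have hμ2 : 1 / 2 ≤ μ := by
    have h1 := Finset.single_le_sum (f := fun i => lacunaryWeight b β i * lacunaryExponent b i)
      (s := Finset.range (J + 1))
      (fun i _ => mul_nonneg (he i) (Nat.cast_nonneg _)) (Finset.mem_range.2 (Nat.succ_pos J))
    simp only [lacunaryExponent, Nat.cast_one, mul_one] at h1
    linarith [half_le_lacunaryWeight_zero b hβ0.le]
  have hμm : μ ≤ m := by
    calc μ ≤ ∑ i ∈ Finset.range (J + 1), lacunaryWeight b β i * m := by
          refine Finset.sum_le_sum fun i hi => mul_le_mul_of_nonneg_left ?_ (he i)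
          rw [hm, Nat.cast_le]
          exact hmono.monotone (Nat.lt_succ_iff.1 (Finset.mem_range.1 hi))
      _ = (∑ i ∈ Finset.range (J + 1), lacunaryWeight b β i) * m := by rw [Finset.sum_mul]
      _ ≤ m := mul_le_of_le_one_left (by linarith) (sum_le_hasSum _ (fun i _ => he i) hs)
  have hεeq : ε = (1 / 2) ^ (J + 2) * n ^ (-β) := rfl
  -- The shift 8 against the 2 in the weights leaves `2 ^ 6`, more than the `2π` in `r`.
  have hεL : n * ε * L = 64 * m * n ^ (1 - β) := by
    have h1 : (1 / 2 : ℝ) ^ (J + 2) * 2 ^ (J + 8) = 64 := by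
      rw [show J + 8 = (J + 2) + 6 by ring, pow_add (2 : ℝ), ← mul_assoc, ← mul_pow]
      norm_num
    have h2 : n ^ (1 - β) = n * n ^ (-β) := by
      rw [sub_eq_add_neg, Real.rpow_add hn0, Real.rpow_one]
    rw [hεeq, h2, hL]
    linear_combination n * n ^ (-β) * m * h1
  have hε0 : 0 < ε := by rw [hεeq]; positivity
  set s : ℝ := ε + μ / n with hse
  have hs0 : 0 < s := by positivity
  set r : ℝ := 2 * Real.pi * μ / (n * s) with hr
  have hr0 : 0 < r := by positivity
  have hnβ : L ^ 2 ≤ n ^ (1 - β) := by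
    rw [hpow, ← Real.rpow_natCast]
    exact Real.rpow_le_rpow_of_exponent_le (by linarith) (by exact_mod_cast hb2)
  -- the main upper bound for `r`
  have hrL : r ≤ L / n ^ (1 - β) := by
    have h1 : n * ε ≤ n * s := by
      rw [hse]; gcongr
      linarith [show 0 < μ / n by positivity]
    have h2 : r ≤ 2 * Real.pi * m / (n * ε) := by rw [hr]; gcongr
    refine h2.trans ?_
    rw [div_le_div_iff₀ (by positivity) (by positivity), mul_comm L, hεL]
    have : 0 < m * n ^ (1 - β) := by positivity
    nlinarith only [this, hπ']
  have hr4 : r ≤ 1 / 4 := by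
    refine hrL.trans ?_
    rw [div_le_iff₀ (by positivity)]
    nlinarith only [hnβ, hL1]
  have hms : m ^ 2 * s ≤ 1 := by
    have h1 : m ^ 2 * ε ≤ 1 / 4 := by
      have h3 : n ^ (-β) * L ^ 2 ≤ 1 := by
        rw [hpow, ← Real.rpow_natCast, ← Real.rpow_add hL0]
        refine Real.rpow_le_one_of_one_le_of_nonpos (by linarith) ?_
        push_cast
        linarith
      have h4 : (1 / 2 : ℝ) ^ (J + 2) ≤ 1 / 4 := by
        calc (1 / 2 : ℝ) ^ (J + 2) ≤ (1 / 2) ^ 2 :=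
              pow_le_pow_of_le_one (by norm_num) (by norm_num) (by omega)
          _ = _ := by norm_num
      have h5 : n ^ (-β) * m ^ 2 ≤ 1 := by
        refine le_trans ?_ h3
        gcongr
        linarith
      calc m ^ 2 * ε = (1 / 2) ^ (J + 2) * (n ^ (-β) * m ^ 2) := by rw [hεeq]; ring
        _ ≤ 1 / 4 * 1 := by gcongr
        _ = 1 / 4 := by ring
    have h2 : m ^ 2 * (μ / n) ≤ 1 / 4 := by
      rw [← mul_div_assoc, div_le_iff₀ hn0]
      have h3 : (256 * m) ^ 3 ≤ L ^ 3 := by gcongr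
      have h4 : m ^ 2 * μ ≤ m ^ 2 * m := by gcongr
      have h5 : 0 ≤ m ^ 3 := by positivity
      linarith only [h3, h4, hn3, h5]
    rw [hse, mul_add]
    linarith
  have hτn : τ ≤ 1 / n ^ 2 := by
    refine hτle.trans ?_
    have h1 : n ^ b ≤ (lacunaryExponent b (J + 2) : ℝ) := by
      have : lacunaryExponent b (J + 1) ^ b ≤ lacunaryExponent b (J + 2) :=
        Nat.pow_le_pow_left (Nat.le_mul_of_pos_left _ (by positivity)) b
      rw [hn]
      exact_mod_cast this
    calc (lacunaryExponent b (J + 2) : ℝ) ^ (-β) ≤ (n ^ b) ^ (-β) :=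
          Real.rpow_le_rpow_of_nonpos (by positivity) h1 (by linarith)
      _ = n ^ (-(b * β)) := by
          rw [← Real.rpow_natCast, ← Real.rpow_mul hn0.le]
          congr 1
          ring
      _ ≤ n ^ (-2 : ℝ) := Real.rpow_le_rpow_of_exponent_le (by linarith) (by linarith)
      _ = 1 / n ^ 2 := by rw [Real.rpow_neg hn0.le, one_div]; norm_cast
  refine le_trans ?_ (le_integral_norm_R_sparseSeries hmono rfl he hs
    (half_le_lacunaryWeight_zero b hβ0.le) hτ (by linarith) hμ hn hm hse hr (by linarith) hr4 hms
    hτn hint)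
  have hk1 : 1 / (L * r) ≤ 1 / (20 * Real.pi * μ * r) := by
    have : 20 * Real.pi * μ ≤ L := by
      calc 20 * Real.pi * μ ≤ 20 * 3.15 * m := by gcongr
        _ ≤ L := by linarith
    gcongr
  have hk2 : (1 / (L * r)) ^ p * r ^ 2 = L ^ (-p) * r ^ (-(p - 2)) := by
    rw [one_div, Real.inv_rpow (by positivity), ← Real.rpow_neg (by positivity),
      Real.mul_rpow hL0.le hr0.le, mul_assoc, ← Real.rpow_natCast r 2, ← Real.rpow_add hr0]
    congr 2
    push_cast
    ring
  have hk3 : (L / n ^ (1 - β)) ^ (-(p - 2)) = L ^ (-(p - 2) + b * ((1 - β) * (p - 2))) := by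
    rw [hpow, ← Real.rpow_one_sub' hL0.le ?_, ← Real.rpow_mul hL0.le]
    · congr 1
      ring
    · intro h; linarith
  calc (2 : ℝ) ^ J ≤ L := by linarith
    _ = L ^ (1 : ℝ) := (Real.rpow_one L).symm
    -- The exponent is `2 - 2p + b ((1 - β) (p - 2) - 1)`, at least 2 by `hb4`.
    _ ≤ L ^ (-p + (-(p - 2) + b * ((1 - β) * (p - 2))) + b * (-1)) :=
        Real.rpow_le_rpow_of_exponent_le (by linarith) (by linarith)
    _ = L ^ (-p) * (L / n ^ (1 - β)) ^ (-(p - 2)) / n := by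
        rw [Real.rpow_add hL0, Real.rpow_add hL0 (-p), ← hk3, ← hpow, Real.rpow_neg_one,
          div_eq_mul_inv _ n]
    _ ≤ L ^ (-p) * r ^ (-(p - 2)) / n := by
        gcongr ?_ * ?_ / _
        exact Real.rpow_le_rpow_of_nonpos hr0 hrL (by linarith)
    _ = (1 / (L * r)) ^ p * (r ^ 2 / n) := by rw [← hk2]; ring
    _ ≤ (1 / (20 * Real.pi * μ * r)) ^ p * (2 * r ^ 2 / n) := by
        gcongr
        linarith [sq_nonneg r]

end Lacunary

/-! ### Choice of parameters and conclusion. -/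

theorem exists_not_memLp_R {ν p : ℝ} (hν0 : 0 ≤ ν) (hν : ν < 1) (hp : 2 + 1 / (1 - ν) < p) :
    ∃ F ∈ APlus ν, IsAperiodic F ∧ ¬ MemLp (R F) (ENNReal.ofReal p)
      (volume.restrict (Set.Icc (-Real.pi) Real.pi)) := by
  have h1ν : 0 < 1 - ν := by linarith
  have hp2 : 1 < p - 2 := by
    have : 1 ≤ 1 / (1 - ν) := by rw [le_div_iff₀ h1ν]; linarith
    linarith
  have hνp : 1 < (1 - ν) * (p - 2) := by
    have : 1 / (1 - ν) < p - 2 := by linarith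
    rwa [div_lt_iff₀' h1ν] at this
  -- `β > ν` secures the moment condition; `β < 1 - 1 / (p - 2)` is the divergence condition `(1 -
  -- β) (p - 2) > 1`.
  obtain ⟨β, hνβ, hβ⟩ : ∃ β, ν < β ∧ β < 1 - 1 / (p - 2) := by
    refine exists_between ?_
    have : 1 / (p - 2) < 1 - ν := by rwa [div_lt_iff₀ (by linarith)]
    linarith
  have hβ0 : 0 < β := by linarith
  have hβ1 : β < 1 := by
    have : 0 < 1 / (p - 2) := by positivity
    linarith
  have hσ : 0 < (1 - β) * (p - 2) - 1 := by
    have : 1 / (p - 2) < 1 - β := by linarith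
    rw [div_lt_iff₀ (by linarith)] at this
    linarith
  obtain ⟨b, hb⟩ := exists_nat_ge
    (max (max (2 / β) (2 / (1 - β))) (max 3 (2 * p / ((1 - β) * (p - 2) - 1))))
  simp only [max_le_iff, div_le_iff₀ hβ0, div_le_iff₀ (sub_pos.2 hβ1), div_le_iff₀ hσ] at hb
  obtain ⟨⟨hb1, hb2⟩, hb3, hb4⟩ := hb
  have hb3' : 3 ≤ b := by exact_mod_cast hb3
  refine ⟨sparseSeries (lacunaryExponent b) (lacunaryWeight b β),
    sparseSeries_mem_APlus (strictMono_lacunaryExponent (by omega)) rfl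
      (lacunaryWeight_nonneg b hβ0.le) (hasSum_lacunaryWeight b hβ0.le)
      (summable_rpow_mul_lacunaryWeight b hνβ.le),
    isAperiodic_sparseSeries rfl (lacunaryWeight_nonneg b hβ0.le)
      (hasSum_lacunaryWeight b hβ0.le) (by linarith [half_le_lacunaryWeight_zero b hβ0.le]),
    fun hmem => ?_⟩
  have hint := hmem.integrable_norm_rpow (by simp; linarith) ENNReal.ofReal_ne_top
  rw [ENNReal.toReal_ofReal (by linarith)] at hint
  obtain ⟨J, hJ⟩ := pow_unbounded_of_one_lt (∫ θ in Set.Icc (-Real.pi) Real.pi,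
    ‖R (sparseSeries (lacunaryExponent b) (lacunaryWeight b β)) θ‖ ^ p) one_lt_two
  exact hJ.not_ge (le_integral_norm_R_lacunary hβ0 (by linarith) hb1 hb2 hb3' hb4 hint J)

theorem corollary5p8 :
    (∀ ν : ℝ, 0 < ν → ν < 1 → ∀ F ∈ APlus ν, IsAperiodic F →
      MemLp (R F) (ENNReal.ofReal (1 + 1 / (1 - ν)))
        (volume.restrict (Set.Icc (-Real.pi) Real.pi))) ∧
    (∀ ν : ℝ, 0 ≤ ν → ν < 1 → ∀ p : ℝ, 2 + 1 / (1 - ν) < p →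
      ∃ F ∈ APlus ν, IsAperiodic F ∧
        ¬ MemLp (R F) (ENNReal.ofReal p)
          (volume.restrict (Set.Icc (-Real.pi) Real.pi))) :=
  ⟨fun _ hν0 hν _ hF hap => memLp_R_of_mem_APlus hν0 hν hF hap,
    fun _ hν0 hν _ hp => exists_not_memLp_R hν0 hν hp⟩
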